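/- Let $\Gamma$ be a metrized graph, that is, a finite connected graph (self-loops and multiple edges are allowed) with a finite non-empty vertex set $V(\Gamma)$ and edge set $E(\Gamma)$, in which each edge $e_i$ is a segment of length $L_i>0$ with end points $p_i,q_i\in V(\Gamma)$. For a vertex $q$ let $\upsilon(q)$ be its valence, i.e. the number of directions emanating from $q$ (a self-loop at $q$ counts twice). Regard $\Gamma$ as an electric circuit in which each edge has resistance equal to its length; let $j_z(x,y)$ be the voltage difference between $x$ and $z$ when unit current enters at $y$ and exits at $z$, and let $r(x,y)=j_x(y,y)$ be the resistance function. For an edge $e_i$ let $\Gamma-e_i$ be the graph obtained by deleting the interior of $e_i$. If $\Gamma-e_i$ is connected, let $\hat{\jmath}$ be the voltage function of $\Gamma-e_i$, let $R_i$ be the resistance between $p_i$ and $q_i$ in $\Gamma-e_i$, and for a vertex $p$ put $$R_{a_i,p}=\hat{\jmath}_{p_i}(p,q_i),\qquad R_{b_i,p}=\hat{\jmath}_{q_i}(p_i,p).$$ If $\Gamma-e_i$ is not connected, put $R_i=\infty$, with $R_{a_i,p}=0$, $R_{b_i,p}=R_i$ if $p$ lies in the component of $\Gamma-e_i$ containing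 $p_i$, and $R_{a_i,p}=R_i$, $R_{b_i,p}=0$ if $p$ lies in the component containing $q_i$; in this case the expressions $\frac{L_i(R_{a_i,p}-R_{b_i,p})^2}{(L_i+R_i)^2}$ and $\frac{L_i}{L_i+R_i}$ stand for their limits as $R_i\to\infty$. Then for every vertex $p\in V(\Gamma)$, $$\sum_{e_i\in E(\Gamma)}\frac{L_i\,(R_{a_i,p}-R_{b_i,p})^2}{(L_i+R_i)^2}=\sum_{e_i\in E(\Gamma)}\frac{L_i}{L_i+R_i}\bigl(r(p_i,p)+r(q_i,p)\bigr)-\sum_{q\in V(\Gamma)}(\upsilon(q)-2)\,r(p,q).$$ -/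

import Mathlib

open Filter Finset

/-- A finite graph (self-loops and multiple edges allowed) with vertices `V` and edges `E`, in which
every edge `e` is a closed segment `[0, len e]` parametrized from its end point `tail e` to its end
point `head e`. A connected such graph (see `LengthGraph.Connected`) is a metrized graph together
with a choice of vertex set; connectedness is not built in because removing an edge may destroy it.
As an electric circuit, the resistance of the edge `e` is its length `len e`. -/
structure LengthGraph (V E : Type*) where
  tail : E → V
  head : E → V
  len : E → ℝ
  len_pos : ∀ e, 0 < len e

namespace LengthGraph

variable {V E : Type*}

/-- The simple graph in which two distinct vertices are adjacent if some edge joins them. -/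
def toSimple (Γ : LengthGraph V E) : SimpleGraph V :=
  SimpleGraph.fromRel fun x y => ∃ e, Γ.tail e = x ∧ Γ.head e = y

/-- `Γ` is non-empty and connected. -/
def Connected (Γ : LengthGraph V E) : Prop := Γ.toSimple.Connected

/-- The vertices `x` and `y` lie in the same connected component of `Γ`. -/
def SameComponent (Γ : LengthGraph V E) (x y : V) : Prop := Γ.toSimple.Reachable x y

/-- `Γ - e`: the interior of the edge `e` is removed, all vertices are kept. -/
def deleteEdge (Γ : LengthGraph V E) (e : E) : LengthGraph V {e' : E // e' ≠ e} where
  tail e' := Γ.tail e'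
  head e' := Γ.head e'
  len e' := Γ.len e'
  len_pos e' := Γ.len_pos e'

open Classical in
/-- The valence of a vertex: the number of directions emanating from it. A self-loop at the vertex
contributes two directions. -/
noncomputable def valence [Fintype E] (Γ : LengthGraph V E) (v : V) : ℕ :=
  #{e : E | Γ.tail e = v} + #{e : E | Γ.head e = v}

open Classical in
/-- The net current that leaves the vertex `v` through the edges at `v`, when the vertices are
held at the voltages `f`: by Ohm's law the current through an edge is the voltage drop along it
divided by its resistance. -/
noncomputable def netCurrent [Fintype E] (Γ : LengthGraph V E) (f : V → ℝ) (v : V) : ℝ :=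
  ∑ e : E, ((if Γ.tail e = v then (f v - f (Γ.head e)) / Γ.len e else 0) +
    (if Γ.head e = v then (f v - f (Γ.tail e)) / Γ.len e else 0))

open Classical in
/-- `f` is the voltage, with reference value `0` at `z`, when unit current enters at `y` and exits
at `z` (Kirchhoff's current law at every vertex). -/
def IsVoltage [Fintype E] (Γ : LengthGraph V E) (z y : V) (f : V → ℝ) : Prop :=
  f z = 0 ∧
    ∀ v, Γ.netCurrent f v = (if v = y then (1 : ℝ) else 0) - (if v = z then (1 : ℝ) else 0)

open Classical in
/-- The voltage function `j_z(x, y)` on vertices: the voltage difference between `x` and `z` when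
unit current enters at `y` and exits at `z`. On a connected finite graph the function `f` below
exists and is unique, see `existsUnique_isVoltage`. -/
noncomputable def voltage [Fintype E] (Γ : LengthGraph V E) (z x y : V) : ℝ :=
  if h : ∃ f, Γ.IsVoltage z y f then h.choose x else 0

/-- The resistance function `r(x, y) = j_x(y, y)`. -/
noncomputable def resistance [Fintype E] (Γ : LengthGraph V E) (x y : V) : ℝ :=
  Γ.voltage x y y

/-! For an edge `e` with end points `p_e = tail e`, `q_e = head e` such that `Γ - e` is connected:
`R_{a,p} = j_{p_e}(p, q_e)`, `R_{b,p} = j_{q_e}(p_e, p)` and `R = r(p_e, q_e)`, all in `Γ - e`. -/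

open Classical in
/-- `R_{a,p}` of the edge `e`, when `Γ - e` is connected. -/
noncomputable def Ra [Fintype E] (Γ : LengthGraph V E) (e : E) (p : V) : ℝ :=
  (Γ.deleteEdge e).voltage (Γ.tail e) p (Γ.head e)

open Classical in
/-- `R_{b,p}` of the edge `e`, when `Γ - e` is connected. -/
noncomputable def Rb [Fintype E] (Γ : LengthGraph V E) (e : E) (p : V) : ℝ :=
  (Γ.deleteEdge e).voltage (Γ.head e) (Γ.tail e) p

open Classical in
/-- `R` of the edge `e`, when `Γ - e` is connected. -/
noncomputable def R [Fintype E] (Γ : LengthGraph V E) (e : E) : ℝ :=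
  (Γ.deleteEdge e).resistance (Γ.tail e) (Γ.head e)

open Classical in
/-- The term `L (R_{a,p} - R_{b,p})² / (L + R)²` of the edge `e`. If `Γ - e` is not connected, then
`R = ∞`, and `(R_{a,p}, R_{b,p})` is `(0, R)` or `(R, 0)` according to whether `p` lies in the
component of `Γ - e` that contains `tail e` or in the one that contains `head e`; the term then is
its limit as `R → ∞`. -/
noncomputable def squareTerm [Fintype E] (Γ : LengthGraph V E) (e : E) (p : V) : ℝ :=
  if (Γ.deleteEdge e).Connected then
    Γ.len e * (Γ.Ra e p - Γ.Rb e p) ^ 2 / (Γ.len e + Γ.R e) ^ 2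
  else if (Γ.deleteEdge e).SameComponent (Γ.tail e) p then
    limUnder atTop fun t : ℝ => Γ.len e * (0 - t) ^ 2 / (Γ.len e + t) ^ 2
  else
    limUnder atTop fun t : ℝ => Γ.len e * (t - 0) ^ 2 / (Γ.len e + t) ^ 2

open Classical in
/-- The coefficient `L / (L + R)` of the edge `e`; if `Γ - e` is not connected, then `R = ∞` and the
coefficient is its limit as `R → ∞`. -/
noncomputable def ratioTerm [Fintype E] (Γ : LengthGraph V E) (e : E) : ℝ :=
  if (Γ.deleteEdge e).Connected then Γ.len e / (Γ.len e + Γ.R e)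
  else limUnder atTop fun t : ℝ => Γ.len e / (Γ.len e + t)

/-! The definitions above are not vacuous: the limits and the voltages exist. -/

theorem tendsto_ratio (L : ℝ) : Tendsto (fun t : ℝ => L / (L + t)) atTop (nhds 0) :=
  tendsto_const_nhds.div_atTop (tendsto_atTop_add_const_left _ _ tendsto_id)

theorem tendsto_square (L : ℝ) :
    Tendsto (fun t : ℝ => L * t ^ 2 / (L + t) ^ 2) atTop (nhds L) := by
  have h : Tendsto (fun t : ℝ => L * (1 - L / (L + t)) ^ 2) atTop (nhds (L * (1 - 0) ^ 2)) :=
    ((tendsto_const_nhds.sub (tendsto_ratio L)).pow 2).const_mul L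
  have h' : L * (1 - 0) ^ 2 = L := by ring
  rw [h'] at h
  refine h.congr' ?_
  filter_upwards [eventually_gt_atTop (-L)] with t ht
  have : L + t ≠ 0 := by linarith
  field_simp
  ring

theorem squareTerm_of_not_connected [Fintype E] (Γ : LengthGraph V E) (e : E) (p : V)
    (h : ¬ (Γ.deleteEdge e).Connected) : Γ.squareTerm e p = Γ.len e := by
  unfold squareTerm
  rw [if_neg h]
  split_ifs
  · simpa using (tendsto_square (Γ.len e)).limUnder_eq
  · simpa using (tendsto_square (Γ.len e)).limUnder_eq

theorem ratioTerm_of_not_connected [Fintype E] (Γ : LengthGraph V E) (e : E)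
    (h : ¬ (Γ.deleteEdge e).Connected) : Γ.ratioTerm e = 0 := by
  unfold ratioTerm
  rw [if_neg h]
  exact (tendsto_ratio (Γ.len e)).limUnder_eq

theorem sum_mul_netCurrent [Fintype V] [Fintype E] (Γ : LengthGraph V E) (f g : V → ℝ) :
    ∑ v, g v * Γ.netCurrent f v =
      ∑ e, (f (Γ.tail e) - f (Γ.head e)) * (g (Γ.tail e) - g (Γ.head e)) / Γ.len e := by
  classical
  unfold netCurrent
  simp_rw [Finset.mul_sum]
  rw [Finset.sum_comm]
  refine Finset.sum_congr rfl fun e _ => ?_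
  simp only [mul_add, Finset.sum_add_distrib, mul_ite, mul_zero, Finset.sum_ite_eq,
    Finset.mem_univ, if_true]
  ring

theorem eq_of_netCurrent_eq_zero [Fintype V] [Fintype E] (Γ : LengthGraph V E)
    (hΓ : Γ.Connected) (f : V → ℝ) (hf : ∀ v, f v * Γ.netCurrent f v = 0) (x y : V) :
    f x = f y := by
  have h0 : ∑ e, (f (Γ.tail e) - f (Γ.head e)) * (f (Γ.tail e) - f (Γ.head e)) / Γ.len e = 0 := by
    rw [← sum_mul_netCurrent]
    exact Finset.sum_eq_zero fun v _ => hf v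
  rw [Finset.sum_eq_zero_iff_of_nonneg
    (fun e _ => div_nonneg (mul_self_nonneg _) (Γ.len_pos e).le)] at h0
  have h1 : ∀ e, f (Γ.tail e) = f (Γ.head e) := fun e => by
    have h2 := h0 e (Finset.mem_univ e)
    rw [div_eq_zero_iff, or_iff_left (Γ.len_pos e).ne', mul_self_eq_zero] at h2
    exact sub_eq_zero.mp h2
  obtain ⟨w⟩ := hΓ.preconnected x y
  induction w with
  | nil => rfl
  | cons hadj _ ih =>
    rw [← ih]
    rw [toSimple, SimpleGraph.fromRel_adj] at hadj
    obtain ⟨_, ⟨e, rfl, rfl⟩ | ⟨e, rfl, rfl⟩⟩ := hadj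
    · exact h1 e
    · exact (h1 e).symm

/-- `f ↦ netCurrent f`, with the value at `z` replaced by `f z`, as a linear map. -/
theorem exists_linearMap [Fintype E] (Γ : LengthGraph V E) (z : V) :
    ∃ T : (V → ℝ) →ₗ[ℝ] (V → ℝ), ∀ f, T f z = f z ∧ ∀ v, v ≠ z → T f v = Γ.netCurrent f v := by
  classical
  refine ⟨{ toFun := fun f v => if v = z then f z else Γ.netCurrent f v
            map_add' := ?_
            map_smul' := ?_ }, fun f => ⟨if_pos rfl, fun v hv => if_neg hv⟩⟩
  · intro f g
    ext v
    by_cases hv : v = z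
    · simp [hv]
    · simp only [hv, if_false, Pi.add_apply, netCurrent, ← Finset.sum_add_distrib]
      refine Finset.sum_congr rfl fun e _ => ?_
      split_ifs <;> ring
  · intro c f
    ext v
    by_cases hv : v = z
    · simp [hv]
    · simp only [hv, if_false, Pi.smul_apply, netCurrent, RingHom.id_apply,
        smul_eq_mul, Finset.mul_sum]
      refine Finset.sum_congr rfl fun e _ => ?_
      split_ifs <;> ring

/-- On a connected finite graph the voltage exists and is unique. -/
theorem existsUnique_isVoltage [Fintype V] [Fintype E] (Γ : LengthGraph V E)
    (hΓ : Γ.Connected) (z y : V) : ∃! f, Γ.IsVoltage z y f := by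
  classical
  obtain ⟨T, hT⟩ := Γ.exists_linearMap z
  have hinj : Function.Injective T := by
    rw [← LinearMap.ker_eq_bot, LinearMap.ker_eq_bot']
    intro f hf
    have hz : f z = 0 := by rw [← (hT f).1, hf]; rfl
    have hc := Γ.eq_of_netCurrent_eq_zero hΓ f (fun v => by
      by_cases hv : v = z
      · rw [hv, hz, zero_mul]
      · rw [← (hT f).2 v hv, hf]; simp)
    ext v
    rw [hc v z, hz]; rfl
  have hkey : ∀ f, Γ.IsVoltage z y f ↔
      T f = fun v => if v = z then 0 else if v = y then 1 else 0 := by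
    intro f
    constructor
    · rintro ⟨h1, h2⟩
      ext v
      by_cases hv : v = z
      · rw [hv, (hT f).1, h1]; simp
      · rw [(hT f).2 v hv, h2 v]; simp [hv]
    · intro h
      have hoff : ∀ v, v ≠ z → Γ.netCurrent f v =
          (if v = y then (1 : ℝ) else 0) - (if v = z then (1 : ℝ) else 0) := fun v hv => by
        rw [← (hT f).2 v hv, h]; simp [hv]
      refine ⟨by rw [← (hT f).1, h]; simp, fun v => ?_⟩
      by_cases hv : v = z
      · subst hv
        have hs : ∑ u, Γ.netCurrent f u = 0 := by
          simpa using Γ.sum_mul_netCurrent f (fun _ => 1)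
        have hs' : ∑ u, ((if u = y then (1 : ℝ) else 0) - (if u = v then (1 : ℝ) else 0)) = 0 := by
          simp [Finset.sum_sub_distrib]
        rw [← Finset.add_sum_erase _ _ (Finset.mem_univ v)] at hs hs'
        rw [Finset.sum_congr rfl fun u hu => hoff u (Finset.ne_of_mem_erase hu)] at hs
        linarith
      · exact hoff v hv
  obtain ⟨f, hf⟩ := (LinearMap.injective_iff_surjective.mp hinj)
    (fun v => if v = z then 0 else if v = y then 1 else 0)
  exact ⟨f, (hkey f).2 hf, fun g hg => hinj (((hkey g).1 hg).trans hf.symm)⟩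

end LengthGraph

/-! ### Linearity of the net current; deletion of an edge. -/

namespace LengthGraph

variable {V E : Type*}

/-! Fix `p` and let `g(x, y) = j_p(x, y)`, a symmetric kernel with `r(p, x) = g(x, x)` and `r(x, y)
= g(x, x) + g(y, y) - 2 g(x, y)`. For an edge of length `L` with ends `t`, `h`, put `a = g(t, t)`,
`b = g(h, h)`, `c = g(t, h)`.

Deleting the edge changes `g` by a rank-one term, so data of `Γ - e` become data of `Γ`: the
coefficient `L / (L + R)` equals `1 - (a + b - 2c) / L` (`Connected.ratioTerm_eq`) and the square
term equals `(a - b)² / L` (`Connected.squareTerm_eq`). Bridges obey the same formulas.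

The vertex sums also become edge sums. The valence sum is the sum of `a + b` (`sum_valence_mul`),
cancelling the `1` in the coefficients. Kirchhoff's law for `g(·, q)` at `q` turns the sum of `r(p,
q)` into that of `(a(a - c) + b(b - c)) / L` (`Connected.sum_resistance`). What remains holds edge
by edge: `(a - b)² = 2a(a - c) + 2b(b - c) - (a + b - 2c)(a + b)`. -/

theorem netCurrent_add [Fintype E] (Γ : LengthGraph V E) (f g : V → ℝ) (v : V) :
    Γ.netCurrent (fun x => f x + g x) v = Γ.netCurrent f v + Γ.netCurrent g v := by
  classical
  simp only [netCurrent, ← Finset.sum_add_distrib]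
  refine Finset.sum_congr rfl fun e _ => ?_
  split_ifs <;> ring

theorem netCurrent_const_mul [Fintype E] (Γ : LengthGraph V E) (c : ℝ) (f : V → ℝ) (v : V) :
    Γ.netCurrent (fun x => c * f x) v = c * Γ.netCurrent f v := by
  classical
  simp only [netCurrent, Finset.mul_sum]
  refine Finset.sum_congr rfl fun e _ => ?_
  split_ifs <;> ring

theorem netCurrent_sub [Fintype E] (Γ : LengthGraph V E) (f g : V → ℝ) (v : V) :
    Γ.netCurrent (fun x => f x - g x) v = Γ.netCurrent f v - Γ.netCurrent g v := by
  classical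
  simp only [netCurrent, ← Finset.sum_sub_distrib]
  refine Finset.sum_congr rfl fun e _ => ?_
  split_ifs <;> ring

theorem netCurrent_const [Fintype E] (Γ : LengthGraph V E) (c : ℝ) (v : V) :
    Γ.netCurrent (fun _ => c) v = 0 := by
  simp [netCurrent]

open Classical in
/-- The current leaving a vertex splits into the current through the edge `e` and the current
in `Γ - e`. -/
theorem netCurrent_eq_deleteEdge_add [Fintype E] (Γ : LengthGraph V E) (e : E) (f : V → ℝ)
    (v : V) :
    Γ.netCurrent f v = (Γ.deleteEdge e).netCurrent f v +
      ((if v = Γ.tail e then (1 : ℝ) else 0) - (if v = Γ.head e then (1 : ℝ) else 0)) *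
        ((f (Γ.tail e) - f (Γ.head e)) / Γ.len e) := by
  unfold netCurrent
  rw [Fintype.sum_eq_add_sum_subtype_ne _ e, add_comm]
  congr 1
  have h1 : (if Γ.tail e = v then (f v - f (Γ.head e)) / Γ.len e else 0) =
      (if v = Γ.tail e then 1 else 0) * ((f (Γ.tail e) - f (Γ.head e)) / Γ.len e) := by
    by_cases h : v = Γ.tail e
    · simp [h]
    · simp [h, Ne.symm h]
  have h2 : (if Γ.head e = v then (f v - f (Γ.tail e)) / Γ.len e else 0) =
      -(if v = Γ.head e then 1 else 0) * ((f (Γ.tail e) - f (Γ.head e)) / Γ.len e) := by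
    by_cases h : v = Γ.head e
    · simp only [h, if_true]; ring
    · simp [h, Ne.symm h]
  rw [h1, h2]
  ring

/-- A walk in `Γ` survives in `Γ - e` once each passage through `e` is replaced by a detour. -/
theorem deleteEdge_connected_of_sameComponent {Γ : LengthGraph V E} (hΓ : Γ.Connected) {e : E}
    (h : (Γ.deleteEdge e).SameComponent (Γ.tail e) (Γ.head e)) :
    (Γ.deleteEdge e).Connected := by
  have hadj : ∀ e', (Γ.deleteEdge e).toSimple.Reachable (Γ.tail e') (Γ.head e') := fun e' => by
    by_cases he : e' = e
    · rw [he]; exact h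
    · by_cases hne : Γ.tail e' = Γ.head e'
      · rw [hne]
      · refine SimpleGraph.Adj.reachable ?_
        rw [toSimple, SimpleGraph.fromRel_adj]
        exact ⟨hne, Or.inl ⟨⟨e', he⟩, rfl, rfl⟩⟩
  have := hΓ.nonempty
  refine SimpleGraph.Connected.mk fun x y => ?_
  obtain ⟨w⟩ := hΓ.preconnected x y
  induction w with
  | nil => exact SimpleGraph.Reachable.refl _
  | cons hxy _ ih =>
    refine SimpleGraph.Reachable.trans ?_ ih
    rw [toSimple, SimpleGraph.fromRel_adj] at hxy
    obtain ⟨_, ⟨e', rfl, rfl⟩ | ⟨e', rfl, rfl⟩⟩ := hxy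
    · exact hadj e'
    · exact (hadj e').symm

theorem sameComponent_tail_iff_head (Γ : LengthGraph V E) (x : V) (e : E) :
    Γ.SameComponent x (Γ.tail e) ↔ Γ.SameComponent x (Γ.head e) := by
  have h : Γ.SameComponent (Γ.tail e) (Γ.head e) := by
    by_cases hne : Γ.tail e = Γ.head e
    · rw [hne]; exact SimpleGraph.Reachable.refl _
    · refine SimpleGraph.Adj.reachable ?_
      rw [toSimple, SimpleGraph.fromRel_adj]
      exact ⟨hne, Or.inl ⟨e, rfl, rfl⟩⟩
  exact ⟨fun hx => hx.trans h, fun hx => hx.trans h.symm⟩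

/-! ### Voltage and resistance on a connected graph. -/

section Connected

variable [Fintype V] [Fintype E] {Γ : LengthGraph V E}

theorem Connected.isVoltage_voltage (hΓ : Γ.Connected) (z y : V) :
    Γ.IsVoltage z y (fun x => Γ.voltage z x y) := by
  have h := (Γ.existsUnique_isVoltage hΓ z y).exists
  have h' : (fun x => Γ.voltage z x y) = h.choose := by
    ext x
    simp only [voltage, dif_pos h]
  rw [h']
  exact h.choose_spec

theorem Connected.voltage_eq (hΓ : Γ.Connected) {z y : V} {f : V → ℝ}
    (hf : Γ.IsVoltage z y f) (x : V) : Γ.voltage z x y = f x :=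
  congrFun ((Γ.existsUnique_isVoltage hΓ z y).unique (hΓ.isVoltage_voltage z y) hf) x

theorem Connected.voltage_self (hΓ : Γ.Connected) (z y : V) : Γ.voltage z z y = 0 :=
  (hΓ.isVoltage_voltage z y).1

/-- Reciprocity: both sides are the Dirichlet pairing of the two voltage functions, which is
symmetric. -/
theorem Connected.voltage_comm (hΓ : Γ.Connected) (z x y : V) :
    Γ.voltage z x y = Γ.voltage z y x := by
  classical
  have key : ∀ a b, ∑ v, Γ.voltage z v a * Γ.netCurrent (fun w => Γ.voltage z w b) v =
      Γ.voltage z b a := fun a b => by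
    simp [(hΓ.isVoltage_voltage z b).2, mul_sub, Finset.sum_sub_distrib, hΓ.voltage_self]
  rw [← key y x, ← key x y, sum_mul_netCurrent, sum_mul_netCurrent]
  exact Finset.sum_congr rfl fun e _ => by ring

/-- Change of the reference vertex from `p` to `z`. -/
theorem Connected.voltage_eq_of_base (hΓ : Γ.Connected) (p z x y : V) :
    Γ.voltage z x y =
      Γ.voltage p x y - Γ.voltage p x z - (Γ.voltage p z y - Γ.voltage p z z) := by
  classical
  refine hΓ.voltage_eq (f := fun x => Γ.voltage p x y - Γ.voltage p x z -
    (Γ.voltage p z y - Γ.voltage p z z)) ⟨by ring, fun v => ?_⟩ x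
  rw [netCurrent_sub, netCurrent_sub, netCurrent_const, (hΓ.isVoltage_voltage p y).2,
    (hΓ.isVoltage_voltage p z).2]
  ring

theorem Connected.resistance_eq (hΓ : Γ.Connected) (p x y : V) :
    Γ.resistance x y = Γ.voltage p x x + Γ.voltage p y y - 2 * Γ.voltage p x y := by
  rw [resistance, hΓ.voltage_eq_of_base p, hΓ.voltage_comm p y x]
  ring

theorem Connected.resistance_comm (hΓ : Γ.Connected) (x y : V) :
    Γ.resistance x y = Γ.resistance y x := by
  rw [hΓ.resistance_eq x x y, hΓ.resistance_eq x y x, hΓ.voltage_comm x y x]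
  ring

/-- Resistance is the energy dissipated by the unit current flow. -/
theorem Connected.resistance_nonneg (hΓ : Γ.Connected) (x y : V) : 0 ≤ Γ.resistance x y := by
  classical
  have h : ∑ v, Γ.voltage x v y * Γ.netCurrent (fun w => Γ.voltage x w y) v =
      Γ.resistance x y := by
    simp [(hΓ.isVoltage_voltage x y).2, mul_sub, Finset.sum_sub_distrib, hΓ.voltage_self,
      resistance]
  rw [← h, sum_mul_netCurrent]
  exact Finset.sum_nonneg fun e _ => div_nonneg (mul_self_nonneg _) (Γ.len_pos e).le

theorem Connected.R_nonneg {e : E} (he : (Γ.deleteEdge e).Connected) : 0 ≤ Γ.R e := by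
  classical
  exact he.resistance_nonneg _ _

/-! ### Edge terms expressed through the voltages of `Γ`. -/

open Classical in
/-- Inserting the edge `e` changes the voltage function by a matrix of rank one. -/
theorem Connected.voltage_eq_deleteEdge (hΓ : Γ.Connected) {e : E}
    (he : (Γ.deleteEdge e).Connected) (p x y : V) :
    Γ.voltage p x y = (Γ.deleteEdge e).voltage p x y -
      ((Γ.deleteEdge e).voltage p y (Γ.tail e) - (Γ.deleteEdge e).voltage p y (Γ.head e)) /
        (Γ.len e + Γ.R e) *
      ((Γ.deleteEdge e).voltage p x (Γ.tail e) - (Γ.deleteEdge e).voltage p x (Γ.head e)) := by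
  have hL := Γ.len_pos e
  have hR := Connected.R_nonneg he
  have hLR : Γ.len e + Γ.R e ≠ 0 := by linarith
  -- The coefficient is the current `k` through `e`: if `d` is the drop across `e` in `Γ - e`, Ohm's
  -- law requires `d - k R = k L`.
  refine hΓ.voltage_eq (f := fun x => (Γ.deleteEdge e).voltage p x y -
      ((Γ.deleteEdge e).voltage p y (Γ.tail e) - (Γ.deleteEdge e).voltage p y (Γ.head e)) /
        (Γ.len e + Γ.R e) *
      ((Γ.deleteEdge e).voltage p x (Γ.tail e) - (Γ.deleteEdge e).voltage p x (Γ.head e)))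
    ⟨by simp only [he.voltage_self]; ring, fun v => ?_⟩ x
  rw [netCurrent_eq_deleteEdge_add Γ e, netCurrent_sub, netCurrent_const_mul, netCurrent_sub,
    (he.isVoltage_voltage p y).2, (he.isVoltage_voltage p _).2, (he.isVoltage_voltage p _).2]
  have hRe : Γ.R e = _ := he.resistance_eq p (Γ.tail e) (Γ.head e)
  rw [he.voltage_comm p y (Γ.tail e), he.voltage_comm p y (Γ.head e),
    he.voltage_comm p (Γ.head e) (Γ.tail e)]
  generalize (Γ.deleteEdge e).voltage p (Γ.tail e) y = a at *
  generalize (Γ.deleteEdge e).voltage p (Γ.head e) y = b at *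
  have hd : (Γ.deleteEdge e).voltage p (Γ.tail e) (Γ.tail e) = Γ.R e -
      (Γ.deleteEdge e).voltage p (Γ.head e) (Γ.head e) +
      2 * (Γ.deleteEdge e).voltage p (Γ.tail e) (Γ.head e) := by rw [hRe]; ring
  rw [hd]
  field_simp
  ring

/-- The ratio `L / (L + R)` in terms of the resistance across `e` in `Γ`, and the difference of
resistances from the end points of `e`, when `Γ - e` is connected. -/
theorem Connected.ratioTerm_squareTerm_of_connected (hΓ : Γ.Connected) {e : E}
    (he : (Γ.deleteEdge e).Connected) (p : V) :
    Γ.ratioTerm e = 1 - Γ.resistance (Γ.tail e) (Γ.head e) / Γ.len e ∧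
    Γ.squareTerm e p =
      (Γ.voltage p (Γ.tail e) (Γ.tail e) - Γ.voltage p (Γ.head e) (Γ.head e)) ^ 2 /
        Γ.len e := by
  classical
  have hL := Γ.len_pos e
  have hR := Connected.R_nonneg he
  have hLR : Γ.len e + Γ.R e ≠ 0 := by linarith
  have hRe : Γ.R e = _ := he.resistance_eq p (Γ.tail e) (Γ.head e)
  have hRa : Γ.Ra e p = _ := he.voltage_eq_of_base p (Γ.tail e) p (Γ.head e)
  have hRb : Γ.Rb e p = _ := he.voltage_eq_of_base p (Γ.head e) (Γ.tail e) p
  have hp : ∀ x, (Γ.deleteEdge e).voltage p x p = 0 := fun x => by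
    rw [he.voltage_comm, he.voltage_self]
  -- Now `Ra - Rb` is the difference of the diagonal values at the two ends in `Γ - e`; inserting
  -- `e` scales it by `L / (L + R)`.
  simp only [he.voltage_self, hp] at hRa hRb
  rw [ratioTerm, if_pos he, squareTerm, if_pos he, hΓ.resistance_eq p, hRa, hRb]
  simp only [hΓ.voltage_eq_deleteEdge he p]
  rw [he.voltage_comm p (Γ.head e) (Γ.tail e)]
  generalize (Γ.deleteEdge e).voltage p (Γ.tail e) (Γ.head e) = c at *
  generalize (Γ.deleteEdge e).voltage p (Γ.head e) (Γ.head e) = b at *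
  have hd : (Γ.deleteEdge e).voltage p (Γ.tail e) (Γ.tail e) = Γ.R e - b + 2 * c := by
    rw [hRe]; ring
  rw [hd]
  constructor <;> field_simp <;> ring

open Classical in
/-- If `e` is a bridge, unit current from `tail e` to `head e` flows through `e` only. -/
theorem Connected.voltage_sub_of_not_connected (hΓ : Γ.Connected) {e : E}
    (he : ¬ (Γ.deleteEdge e).Connected) (p x : V) :
    Γ.voltage p x (Γ.tail e) - Γ.voltage p x (Γ.head e) =
      Γ.len e * ((if (Γ.deleteEdge e).SameComponent (Γ.tail e) x then 1 else 0) -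
        (if (Γ.deleteEdge e).SameComponent (Γ.tail e) p then 1 else 0)) := by
  have hL := (Γ.len_pos e).ne'
  have hh : ¬ (Γ.deleteEdge e).SameComponent (Γ.tail e) (Γ.head e) := fun h =>
    he (deleteEdge_connected_of_sameComponent hΓ h)
  have ht : (Γ.deleteEdge e).SameComponent (Γ.tail e) (Γ.tail e) :=
    SimpleGraph.Reachable.refl _
  -- `χ` is constant along every edge but `e`, so its only current in `Γ` is `1 / L` through `e`.
  set χ : V → ℝ := fun x => if (Γ.deleteEdge e).SameComponent (Γ.tail e) x then 1 else 0
  have hχt : χ (Γ.tail e) = 1 := if_pos ht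
  have hχh : χ (Γ.head e) = 0 := if_neg hh
  have hχ : ∀ v, (Γ.deleteEdge e).netCurrent χ v = 0 := fun v => by
    refine Finset.sum_eq_zero fun e' _ => ?_
    have h' : χ ((Γ.deleteEdge e).tail e') = χ ((Γ.deleteEdge e).head e') :=
      if_congr (sameComponent_tail_iff_head _ _ e') rfl rfl
    have h1 : (if (Γ.deleteEdge e).tail e' = v then
        (χ v - χ ((Γ.deleteEdge e).head e')) / (Γ.deleteEdge e).len e' else 0) = 0 :=
      ite_eq_right_iff.2 fun h => by rw [← h, h', sub_self, zero_div]
    have h2 : (if (Γ.deleteEdge e).head e' = v then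
        (χ v - χ ((Γ.deleteEdge e).tail e')) / (Γ.deleteEdge e).len e' else 0) = 0 :=
      ite_eq_right_iff.2 fun h => by rw [← h, h', sub_self, zero_div]
    rw [h1, h2, add_zero]
  have key := hΓ.voltage_eq (z := p) (y := Γ.tail e)
    (f := fun x => Γ.voltage p x (Γ.head e) + Γ.len e * (χ x - χ p))
    ⟨by simp [hΓ.voltage_self], fun v => ?_⟩ x
  · rw [key]; ring
  · rw [netCurrent_add, netCurrent_const_mul, netCurrent_sub, netCurrent_const,
      (hΓ.isVoltage_voltage p _).2, netCurrent_eq_deleteEdge_add Γ e χ, hχ, hχt, hχh]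
    field_simp
    ring

theorem Connected.ratioTerm_squareTerm_of_not_connected (hΓ : Γ.Connected) {e : E}
    (he : ¬ (Γ.deleteEdge e).Connected) (p : V) :
    Γ.ratioTerm e = 1 - Γ.resistance (Γ.tail e) (Γ.head e) / Γ.len e ∧
    Γ.squareTerm e p =
      (Γ.voltage p (Γ.tail e) (Γ.tail e) - Γ.voltage p (Γ.head e) (Γ.head e)) ^ 2 /
        Γ.len e := by
  classical
  have hL := (Γ.len_pos e).ne'
  have hh : ¬ (Γ.deleteEdge e).SameComponent (Γ.tail e) (Γ.head e) := fun h =>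
    he (deleteEdge_connected_of_sameComponent hΓ h)
  have ht : (Γ.deleteEdge e).SameComponent (Γ.tail e) (Γ.tail e) :=
    SimpleGraph.Reachable.refl _
  have h1 := hΓ.voltage_sub_of_not_connected he p (Γ.tail e)
  have h2 := hΓ.voltage_sub_of_not_connected he p (Γ.head e)
  rw [if_pos ht] at h1
  rw [if_neg hh, hΓ.voltage_comm p (Γ.head e) (Γ.tail e)] at h2
  rw [Γ.ratioTerm_of_not_connected e he, Γ.squareTerm_of_not_connected e p he,
    hΓ.resistance_eq p]
  have h3 : Γ.voltage p (Γ.tail e) (Γ.tail e) + Γ.voltage p (Γ.head e) (Γ.head e) -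
      2 * Γ.voltage p (Γ.tail e) (Γ.head e) = Γ.len e := by linear_combination h1 - h2
  refine ⟨by rw [h3, div_self hL, sub_self], ?_⟩
  -- The last factor is a sign recording the side of the bridge on which `p` lies; squaring removes
  -- it.
  have h4 : Γ.voltage p (Γ.tail e) (Γ.tail e) - Γ.voltage p (Γ.head e) (Γ.head e) =
      Γ.len e * (1 - 2 * if (Γ.deleteEdge e).SameComponent (Γ.tail e) p then 1 else 0) := by
    linear_combination h1 + h2
  rw [h4]
  split_ifs <;> field_simp <;> ring

theorem Connected.ratioTerm_eq (hΓ : Γ.Connected) (e : E) :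
    Γ.ratioTerm e = 1 - Γ.resistance (Γ.tail e) (Γ.head e) / Γ.len e := by
  by_cases he : (Γ.deleteEdge e).Connected
  · exact (hΓ.ratioTerm_squareTerm_of_connected he (Γ.tail e)).1
  · exact (hΓ.ratioTerm_squareTerm_of_not_connected he (Γ.tail e)).1

theorem Connected.squareTerm_eq (hΓ : Γ.Connected) (e : E) (p : V) :
    Γ.squareTerm e p =
      (Γ.resistance p (Γ.tail e) - Γ.resistance p (Γ.head e)) ^ 2 / Γ.len e := by
  by_cases he : (Γ.deleteEdge e).Connected
  · exact (hΓ.ratioTerm_squareTerm_of_connected he p).2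
  · exact (hΓ.ratioTerm_squareTerm_of_not_connected he p).2

/-! ### Vertex sums as edge sums, and the conclusion. -/

theorem sum_valence_mul (Γ : LengthGraph V E) (f : V → ℝ) :
    ∑ q, (Γ.valence q : ℝ) * f q = ∑ e, (f (Γ.tail e) + f (Γ.head e)) := by
  classical
  have h : ∀ q, (Γ.valence q : ℝ) * f q =
      ∑ e, ((if Γ.tail e = q then f q else 0) + (if Γ.head e = q then f q else 0)) := fun q => by
    rw [valence]
    push_cast
    rw [Finset.sum_add_distrib, add_mul]
    simp only [← Finset.sum_filter, Finset.sum_const, nsmul_eq_mul]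
  simp_rw [h]
  rw [Finset.sum_comm]
  simp [Finset.sum_add_distrib]

/-- The resistance to `p`, summed over all vertices, as a sum over the edges. -/
theorem Connected.sum_resistance (hΓ : Γ.Connected) (p : V) :
    ∑ q, Γ.resistance p q =
      ∑ e, (Γ.resistance p (Γ.tail e) *
          (Γ.resistance p (Γ.tail e) - Γ.voltage p (Γ.tail e) (Γ.head e)) +
        Γ.resistance p (Γ.head e) *
          (Γ.resistance p (Γ.head e) - Γ.voltage p (Γ.tail e) (Γ.head e))) / Γ.len e := by
  classical
  -- The net current at `q` is `1`, except at `q = p`, where source and sink cancel but the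
  -- resistance vanishes.
  have h : ∀ q, Γ.resistance p q =
      Γ.resistance p q * Γ.netCurrent (fun x => Γ.voltage p x q) q := fun q => by
    rw [(hΓ.isVoltage_voltage p q).2]
    by_cases hq : q = p
    · simp [hq, resistance, hΓ.voltage_self]
    · simp [hq]
  rw [Finset.sum_congr rfl fun q _ => h q]
  simp only [netCurrent, Finset.mul_sum]
  rw [Finset.sum_comm]
  refine Finset.sum_congr rfl fun e _ => ?_
  simp only [mul_add, Finset.sum_add_distrib, mul_ite, mul_zero, Finset.sum_ite_eq,
    Finset.mem_univ, if_true, resistance]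
  rw [hΓ.voltage_comm p (Γ.head e) (Γ.tail e)]
  ring

end Connected

end LengthGraph

theorem mainTheorem7 {V E : Type*} [Fintype V] [Fintype E] (Γ : LengthGraph V E)
    (hΓ : Γ.Connected) (p : V) :
    ∑ e : E, Γ.squareTerm e p =
      ∑ e : E, Γ.ratioTerm e * (Γ.resistance (Γ.tail e) p + Γ.resistance (Γ.head e) p)
        - ∑ q : V, ((Γ.valence q : ℝ) - 2) * Γ.resistance p q := by
  simp only [sub_mul, Finset.sum_sub_distrib]
  rw [Γ.sum_valence_mul, ← Finset.mul_sum, hΓ.sum_resistance p, Finset.mul_sum,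
    ← Finset.sum_sub_distrib, ← Finset.sum_sub_distrib]
  refine Finset.sum_congr rfl fun e _ => ?_
  have hL := (Γ.len_pos e).ne'
  have hr : Γ.resistance (Γ.tail e) (Γ.head e) = Γ.resistance p (Γ.tail e) +
      Γ.resistance p (Γ.head e) - 2 * Γ.voltage p (Γ.tail e) (Γ.head e) :=
    hΓ.resistance_eq p _ _
  rw [hΓ.squareTerm_eq, hΓ.ratioTerm_eq, hr, hΓ.resistance_comm _ p, hΓ.resistance_comm _ p]
  field_simp
  ring
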